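/- Call $h:[0,\infty)\to\mathbb{R}$ operator monotone if $h(A)\le h(B)$ for all complex positive semidefinite matrices $A\le B$ of any order $n$. Let $h$ be a non-negative operator monotone function on $[0,\infty)$ that is continuous at $0$. Then the following conditions are equivalent: (i) there is a finite positive measure $\nu$ on $[0,1]$ such that $h(x)=\int_0^1 x^\lambda\,d\nu(\lambda)$ for all $x\in[0,\infty)$ (with $0^0=1$); (ii) the function $t\mapsto h(e^t)$ is absolutely monotone on $\mathbb{R}$, i.e., it is $C^\infty$ and $\frac{d^n}{dt^n}h(e^t)\ge 0$ for all $t\in\mathbb{R}$ and all integers $n\ge 0$; (iii) the function $t\mapsto h(e^{-t})$ is completely monotone on $\mathbb{R}$, i.e., it is $C^\infty$ and $(-1)^n\frac{d^n}{dt^n}h(e^{-t})\ge 0$ for all $t\in\mathbb{R}$ and all integers $n\ge 0$. Suppose moreover that $h(1)=1$, and let $\sigma$ be the operator mean with representing function $h$: $A\,\sigma\,B=A^{1/2}h(A^{-1/2}BA^{-1/2})A^{1/2}$ for positive definite matrices $A,B$, and $A\,\sigma\,B=\lim_{\varepsilon\searrow0}(A+\varepsilon I)\,\sigma\,(B+\varepsilon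 I)$ for positive semidefinite ones. Let $\#_\alpha$ denote the operator mean with representing function $x^\alpha$ ($0\le\alpha\le1$). Then $\sigma$ is a geodesic mean, i.e., there is a probability measure $\nu$ on $[0,1]$ with $A\,\sigma\,B=\int_0^1 A\,\#_\alpha\,B\,d\nu(\alpha)$ for all positive semidefinite matrices $A,B$ of the same order (any order), if and only if $h(e^t)$ is absolutely monotone on $\mathbb{R}$. -/

import Mathlib

open MeasureTheory Set Filter Topology
open scoped ContDiff ComplexOrder

/-- `h` is operator monotone on `[0,∞)`: for positive semidefinite complex matrices `A ≤ B` of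
any order, `h(A) ≤ h(B)` in the Loewner order. Here `h(A)` is the functional calculus of the
Hermitian matrix `A` (no continuity of `h` is needed for it, the spectrum being finite). -/
def OperatorMonotone (h : ℝ → ℝ) : Prop :=
  ∀ (n : ℕ) (A B : Matrix (Fin n) (Fin n) ℂ), A.PosSemidef → B.PosSemidef →
    (B - A).PosSemidef → (cfc h B - cfc h A).PosSemidef

/-- `g` is completely monotone on `ℝ`. -/
def CompletelyMonotone (g : ℝ → ℝ) : Prop :=
  ContDiff ℝ ∞ g ∧ ∀ (n : ℕ) (t : ℝ), 0 ≤ (-1 : ℝ) ^ n * iteratedDeriv n g t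

/-- `A^{1/2} h(A^{-1/2} B A^{-1/2}) A^{1/2}`, for positive definite `A` and `B`. -/
noncomputable def posDefMean {n : ℕ} (h : ℝ → ℝ) (A B : Matrix (Fin n) (Fin n) ℂ) :
    Matrix (Fin n) (Fin n) ℂ :=
  cfc Real.sqrt A * cfc h ((cfc Real.sqrt A)⁻¹ * B * (cfc Real.sqrt A)⁻¹) * cfc Real.sqrt A

/-- The operator mean `A σ B` with representing function `h`, on positive semidefinite matrices:
the limit of `(A + ε I) σ (B + ε I)` as `ε` decreases to `0`, where the mean of positive definite
matrices is given by the formula in `posDefMean`. -/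
noncomputable def operatorMean {n : ℕ} (h : ℝ → ℝ) (A B : Matrix (Fin n) (Fin n) ℂ) :
    Matrix (Fin n) (Fin n) ℂ :=
  limUnder (𝓝[>] (0 : ℝ)) fun ε : ℝ =>
    posDefMean h (A + (ε : ℂ) • (1 : Matrix (Fin n) (Fin n) ℂ))
      (B + (ε : ℂ) • (1 : Matrix (Fin n) (Fin n) ℂ))

/-- The weighted geometric mean `A #_α B`, the operator mean with representing function `x ^ α`. -/
noncomputable def weightedGeometricMean {n : ℕ} (α : ℝ) (A B : Matrix (Fin n) (Fin n) ℂ) :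
    Matrix (Fin n) (Fin n) ℂ :=
  operatorMean (fun x : ℝ => x ^ α) A B

/-- The operator mean `σ` with representing function `h` is a geodesic mean:
`A σ B = ∫ A #_α B dν(α)` for one probability measure `ν` on `[0,1]` and all positive semidefinite
`A`, `B` of any order. The integral of matrices is taken entry by entry. -/
def IsGeodesicMean (h : ℝ → ℝ) : Prop :=
  ∃ ν : Measure unitInterval, IsProbabilityMeasure ν ∧
    ∀ (n : ℕ) (A B : Matrix (Fin n) (Fin n) ℂ), A.PosSemidef → B.PosSemidef → ∀ i j : Fin n,
      Integrable (fun α : unitInterval => weightedGeometricMean (α : ℝ) A B i j) ν ∧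
        operatorMean h A B i j = ∫ α : unitInterval, weightedGeometricMean (α : ℝ) A B i j ∂ν

/-! Put `f(t) = h(e^t)`. If `h` is a mixture of powers, then `f` is the moment generating function
of a measure on `[0,1]`, and its derivatives `∫ λ^n e^(tλ) dν` are nonnegative. The converse is
Bernstein's theorem with the measure confined to `[0,1]` (`exists_measure_of_iteratedDeriv_nonneg`).
An absolutely monotone `f` is the sum of its Taylor series about `-N`; at the point `N(e^(s/N) - 1)`
that series is the moment generating function at `s` of a discrete measure with atoms `n/N`. The
points tend to `s`, so a weak limit of these measures represents `f`. Mass beyond `1` disappears in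
the limit because `f` grows at most like `e^t`. This growth bound comes from operator monotonicity:
a comparison of matrices of order two yields `h a ≤ h 1 * a` for `a ≥ 1`
(`OperatorMonotone.le_mul`). Continuity of `h` at `0` extends the representation to `x = 0`.

For means of positive definite matrices, the entries are linear in the representing function, so a
mixture of powers gives a mixture of weighted geometric means. Joint monotonicity of the latter
supplies the limits and the dominating function for the semidefinite case
(`operatorMean_apply_eq_integral`). Conversely, matrices of order one reveal one-sided limits of
`h`, and monotonicity of `h` with continuity of the mixture recovers `h` itself
(`eq_integral_rpow_of_operatorMean`). -/

/-! ### Absolutely monotone functions and Bernstein's theorem. -/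

/-- Taylor's formula with Lagrange remainder, for a smooth function on the line. -/
lemma exists_taylor_lagrange {f : ℝ → ℝ} (hf : ContDiff ℝ ∞ f) {a t : ℝ} (hat : a < t) (n : ℕ) :
    ∃ ξ ∈ Ioo a t, f t = ∑ k ∈ Finset.range (n + 1),
      iteratedDeriv k f a * (t - a) ^ k / (k.factorial : ℝ) +
        iteratedDeriv (n + 1) f ξ * (t - a) ^ (n + 1) / ((n + 1).factorial : ℝ) := by
  obtain ⟨ξ, hξ, h⟩ := taylor_mean_remainder_lagrange_iteratedDeriv (f := f) (n := n) hat.ne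
    ((hf.of_le (by exact_mod_cast le_top)).contDiffOn)
  rw [uIoo_of_lt hat] at hξ
  refine ⟨ξ, hξ, ?_⟩
  rw [← h, taylor_within_apply, uIcc_of_lt hat]
  have : ∀ k ∈ Finset.range (n + 1), ((k.factorial : ℝ)⁻¹ * (t - a) ^ k) •
      iteratedDerivWithin k f (Icc a t) a =
        iteratedDeriv k f a * (t - a) ^ k / (k.factorial : ℝ) := by
    intro k _
    rw [iteratedDerivWithin_eq_iteratedDeriv (uniqueDiffOn_Icc hat)
      (hf.of_le (by exact_mod_cast le_top)).contDiffAt (left_mem_Icc.2 hat.le), smul_eq_mul]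
    ring
  rw [Finset.sum_congr rfl this]
  ring

lemma monotone_iteratedDeriv {f : ℝ → ℝ} (hf : ContDiff ℝ ∞ f)
    (hn : ∀ (n : ℕ) (t : ℝ), 0 ≤ iteratedDeriv n f t) (n : ℕ) : Monotone (iteratedDeriv n f) := by
  refine monotone_of_deriv_nonneg ?_ fun t => ?_
  · exact (hf.differentiable_iteratedDeriv n (by exact_mod_cast WithTop.coe_lt_top n))
  · rw [← iteratedDeriv_succ]; exact hn _ _

/-- A one-sided Cauchy estimate: all the other Taylor terms and the remainder are nonnegative, so
they can be dropped. -/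
lemma iteratedDeriv_mul_pow_div_le {f : ℝ → ℝ} (hf : ContDiff ℝ ∞ f)
    (hn : ∀ (n : ℕ) (t : ℝ), 0 ≤ iteratedDeriv n f t) {a t : ℝ} (hat : a < t) (n : ℕ) :
    iteratedDeriv n f a * (t - a) ^ n / (n.factorial : ℝ) ≤ f t := by
  obtain ⟨ξ, -, h⟩ := exists_taylor_lagrange hf hat n
  have hta : 0 < t - a := sub_pos.2 hat
  have h1 : ∀ (k : ℕ) (s : ℝ), 0 ≤ iteratedDeriv k f s * (t - a) ^ k / (k.factorial : ℝ) :=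
    fun k s => div_nonneg (mul_nonneg (hn k s) (by positivity)) (by positivity)
  have h2 := Finset.single_le_sum (f := fun k : ℕ => iteratedDeriv k f a * (t - a) ^ k /
    (k.factorial : ℝ)) (fun k _ => h1 k a) (Finset.self_mem_range_succ n)
  have h3 := h1 (n + 1) ξ
  linarith

/-- An absolutely monotone function on the line is the sum of its Taylor series to the right of
any base point. -/
lemma hasSum_taylor_of_iteratedDeriv_nonneg {f : ℝ → ℝ} (hf : ContDiff ℝ ∞ f)
    (hn : ∀ (n : ℕ) (t : ℝ), 0 ≤ iteratedDeriv n f t) {a t : ℝ} (hat : a < t) :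
    HasSum (fun n : ℕ => iteratedDeriv n f a * (t - a) ^ n / (n.factorial : ℝ)) (f t) := by
  have hta : 0 < t - a := sub_pos.2 hat
  rw [hasSum_iff_tendsto_nat_of_nonneg
    (fun k => div_nonneg (mul_nonneg (hn k a) (by positivity)) (by positivity)),
    ← tendsto_add_atTop_iff_nat 1]
  have hlow : Tendsto (fun n : ℕ => f t - f (t + 2 * (t - a)) * (1 / 2 : ℝ) ^ (n + 1)) atTop
      (𝓝 (f t)) := by
    have h := ((tendsto_pow_atTop_nhds_zero_of_lt_one (r := (1 / 2 : ℝ)) (by norm_num)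
      (by norm_num)).comp (tendsto_add_atTop_nat 1)).const_mul (f (t + 2 * (t - a)))
    simpa using h.const_sub (f t)
  refine tendsto_of_tendsto_of_tendsto_of_le_of_le hlow tendsto_const_nhds (fun n => ?_)
    (fun n => ?_)
  · obtain ⟨ξ, hξ, h⟩ := exists_taylor_lagrange hf hat n
    -- With `d = t - a`, the Cauchy estimate is applied from `t` with the doubled step `2d`;
    -- rescaling to step `d` gains the factor `2^(-(n+1))` that kills the remainder.
    have h1 := iteratedDeriv_mul_pow_div_le hf hn (a := t) (t := t + 2 * (t - a)) (by linarith)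
      (n + 1)
    have h2 := monotone_iteratedDeriv hf hn (n + 1) hξ.2.le
    have h3 : iteratedDeriv (n + 1) f ξ * (t - a) ^ (n + 1) / ((n + 1).factorial : ℝ) ≤
        iteratedDeriv (n + 1) f t * (t - a) ^ (n + 1) / ((n + 1).factorial : ℝ) := by gcongr
    have h4 : iteratedDeriv (n + 1) f t * (t - a) ^ (n + 1) / ((n + 1).factorial : ℝ) =
        (iteratedDeriv (n + 1) f t * (t + 2 * (t - a) - t) ^ (n + 1) /
          ((n + 1).factorial : ℝ)) * (1 / 2 : ℝ) ^ (n + 1) := by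
      rw [add_sub_cancel_left, mul_pow, one_div, inv_pow]
      field_simp
    have h5 : (iteratedDeriv (n + 1) f t * (t + 2 * (t - a) - t) ^ (n + 1) /
        ((n + 1).factorial : ℝ)) * (1 / 2 : ℝ) ^ (n + 1) ≤
          f (t + 2 * (t - a)) * (1 / 2 : ℝ) ^ (n + 1) := by gcongr
    simp only
    linarith
  · obtain ⟨ξ, hξ, h⟩ := exists_taylor_lagrange hf hat n
    have h1 : 0 ≤ iteratedDeriv (n + 1) f ξ * (t - a) ^ (n + 1) / ((n + 1).factorial : ℝ) :=
      div_nonneg (mul_nonneg (hn _ _) (by positivity)) (by positivity)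
    simp only
    linarith

/-- Discrete probability measures on the unit interval whose moment generating functions converge
pointwise have a limit measure with the limiting moment generating function. -/
lemma exists_probabilityMeasure_of_tendsto_tsum {w : ℕ → ℕ → ℝ} {p : ℕ → ℕ → unitInterval}
    {g : ℝ → ℝ} (hw : ∀ N n, 0 ≤ w N n) (hsum : ∀ N, HasSum (w N) 1)
    (hlim : ∀ s : ℝ, Tendsto (fun N => ∑' n, w N n * Real.exp (s * (p N n : ℝ))) atTop
      (𝓝 (g s))) :
    ∃ ν : Measure unitInterval, IsProbabilityMeasure ν ∧
      ∀ s : ℝ, g s = ∫ l : unitInterval, Real.exp (s * (l : ℝ)) ∂ν := by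
  let q : ℕ → PMF ℕ := fun N => ⟨fun n => ENNReal.ofReal (w N n), by
    have h := ENNReal.ofReal_tsum_of_nonneg (hw N) (hsum N).summable
    rw [(hsum N).tsum_eq, ENNReal.ofReal_one] at h
    rw [h]; exact ENNReal.summable.hasSum⟩
  have hpm : ∀ N, Measurable (p N) := fun N => measurable_of_countable _
  let P : ℕ → ProbabilityMeasure unitInterval := fun N =>
    ⟨(q N).toMeasure.map (p N), Measure.isProbabilityMeasure_map (hpm N).aemeasurable⟩
  -- Probability measures on a compact space form a compact space, so an ultrafilter limit exists
  -- without extracting a subsequence.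
  let U : Ultrafilter (ProbabilityMeasure unitInterval) := (hyperfilter ℕ).map P
  obtain ⟨ν, hν⟩ : ∃ ν, (U : Filter _) ≤ 𝓝 ν := ⟨U.lim, U.le_nhds_lim⟩
  have hU : Tendsto P (hyperfilter ℕ) (𝓝 ν) := hν
  refine ⟨ν, inferInstance, fun s => ?_⟩
  have hc : Continuous fun l : unitInterval => Real.exp (s * (l : ℝ)) := by fun_prop
  have h1 := (ProbabilityMeasure.tendsto_iff_forall_integral_tendsto.1 hU)
    (BoundedContinuousFunction.mkOfCompact ⟨_, hc⟩)
  have h2 : ∀ N, ∫ l, Real.exp (s * (l : ℝ)) ∂(P N : Measure unitInterval) =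
      ∑' n, w N n * Real.exp (s * (p N n : ℝ)) := by
    intro N
    change ∫ l, Real.exp (s * (l : ℝ)) ∂((q N).toMeasure.map (p N)) = _
    rw [integral_map (hpm N).aemeasurable hc.aestronglyMeasurable, PMF.integral_eq_tsum]
    · refine tsum_congr fun n => ?_
      change (ENNReal.ofReal (w N n)).toReal • _ = _
      rw [ENNReal.toReal_ofReal (hw N n), smul_eq_mul]
    · refine Integrable.of_bound (measurable_of_countable _).aestronglyMeasurable
        (Real.exp |s|) (Eventually.of_forall fun n => ?_)
      rw [Real.norm_eq_abs, abs_of_pos (Real.exp_pos _)]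
      refine Real.exp_le_exp.2 ((le_abs_self _).trans ?_)
      rw [abs_mul, abs_of_nonneg (p N n).2.1]
      exact mul_le_of_le_one_right (abs_nonneg _) (p N n).2.2
  simp only [BoundedContinuousFunction.mkOfCompact_apply, ContinuousMap.coe_mk, h2] at h1
  exact tendsto_nhds_unique ((hlim s).mono_left Nat.hyperfilter_le_atTop) h1

/-- Controls the error of moving atoms beyond `1` back to `1`. The factor `1 / k` comes from `l - 1
≤ e^(k(l-1)) / k`. After summation, `e^(-k)` balances the growth of `f` at `k + |s|`, leaving a
bound of order `1 / k`. -/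
lemma abs_exp_sub_exp_min_one_le {k : ℝ} (hk : 0 < k) (s l : ℝ) :
    |Real.exp (s * l) - Real.exp (s * min l 1)| ≤
      |s| / k * Real.exp (-k) * Real.exp ((k + |s|) * l) := by
  rcases le_total l 1 with hl | hl
  · rw [min_eq_left hl, sub_self, abs_zero]; positivity
  rw [min_eq_right hl, mul_one]
  have key : ∀ x y : ℝ, Real.exp x - Real.exp y ≤ |x - y| * Real.exp (max x y) := by
    intro x y
    have h1 := Real.add_one_le_exp (y - x)
    have h2 : Real.exp y = Real.exp x * Real.exp (y - x) := by rw [← Real.exp_add]; ring_nf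
    have h3 : Real.exp x - Real.exp y ≤ (x - y) * Real.exp x := by
      rw [h2]; nlinarith [Real.exp_pos x]
    calc _ ≤ (x - y) * Real.exp x := h3
      _ ≤ |x - y| * Real.exp x := by gcongr; exact le_abs_self _
      _ ≤ _ := by gcongr; exact le_max_left _ _
  have h1 : |Real.exp (s * l) - Real.exp s| ≤ |s * l - s| * Real.exp (max (s * l) s) := by
    rw [abs_le]
    have a := key (s * l) s
    have b := key s (s * l)
    rw [abs_sub_comm, max_comm] at b
    constructor <;> linarith
  have h2 : |s * l - s| = |s| * (l - 1) := by
    rw [← mul_sub_one, abs_mul, abs_of_nonneg (sub_nonneg.2 hl)]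
  have h3 : max (s * l) s ≤ |s| * l := by
    refine max_le ?_ ?_
    · gcongr; exact le_abs_self s
    · nlinarith [le_abs_self s, abs_nonneg s]
  have h4 : l - 1 ≤ Real.exp (k * (l - 1)) / k := by
    rw [le_div_iff₀ hk]
    have := Real.add_one_le_exp (k * (l - 1))
    linarith
  calc _ ≤ _ := h1
    _ ≤ |s| * (Real.exp (k * (l - 1)) / k) * Real.exp (|s| * l) := by
        rw [h2]; gcongr
    _ = _ := by
        have : Real.exp (k * (l - 1)) = Real.exp (-k) * Real.exp (k * l) := by
          rw [← Real.exp_add]; ring_nf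
        rw [this, add_mul, Real.exp_add]; ring

lemma tendsto_mul_exp_div_sub_one (s : ℝ) :
    Tendsto (fun N : ℕ => ((N : ℝ) + 1) * (Real.exp (s / ((N : ℝ) + 1)) - 1)) atTop (𝓝 s) := by
  have h : HasDerivAt (fun u : ℝ => Real.exp (s * u)) s 0 := by
    simpa using ((hasDerivAt_id (0 : ℝ)).const_mul s).exp
  have h2 := (hasDerivAt_iff_tendsto_slope_zero.1 h).comp
    (tendsto_nhdsWithin_iff.2 ⟨tendsto_one_div_add_atTop_nhds_zero_nat (𝕜 := ℝ),
      Eventually.of_forall fun N => by simp; positivity⟩)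
  refine h2.congr fun N => ?_
  simp [div_eq_mul_inv]

/-- Bernstein's theorem for absolutely monotone functions on the line of exponential growth at
most `1`. -/
theorem exists_measure_of_iteratedDeriv_nonneg {f : ℝ → ℝ} (hf : ContDiff ℝ ∞ f)
    (hn : ∀ (n : ℕ) (t : ℝ), 0 ≤ iteratedDeriv n f t)
    (hgrowth : ∀ t : ℝ, 0 ≤ t → f t ≤ f 0 * Real.exp t) :
    ∃ ν : Measure unitInterval, IsFiniteMeasure ν ∧
      ∀ t : ℝ, f t = ∫ l : unitInterval, Real.exp (t * (l : ℝ)) ∂ν := by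
  have hf0 : ∀ t, 0 ≤ f t := fun t => by simpa using hn 0 t
  have hfm : Monotone f := by simpa using monotone_iteratedDeriv hf hn 0
  rcases (hf0 0).eq_or_lt with h0 | h0
  · refine ⟨0, inferInstance, fun t => ?_⟩
    rw [integral_zero_measure]
    rcases le_total t 0 with ht | ht
    · exact le_antisymm ((hfm ht).trans h0.symm.le) (hf0 t)
    · exact le_antisymm (by simpa [← h0] using hgrowth t ht) (hf0 t)
  -- Normalised Taylor weights about `-(N+1)`; they sum to `1` because the series at `0` has sum `f
  -- 0`.
  let w : ℕ → ℕ → ℝ := fun N n =>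
    iteratedDeriv n f (-((N : ℝ) + 1)) * ((N : ℝ) + 1) ^ n / (n.factorial : ℝ) / f 0
  have hw : ∀ N n, 0 ≤ w N n := fun N n =>
    div_nonneg (div_nonneg (mul_nonneg (hn _ _) (by positivity)) (by positivity)) h0.le
  have hexp : ∀ (s : ℝ) (N : ℕ), HasSum
      (fun n : ℕ => w N n * Real.exp (s * ((n : ℝ) / ((N : ℝ) + 1))))
      (f (((N : ℝ) + 1) * (Real.exp (s / ((N : ℝ) + 1)) - 1)) / f 0) := by
    intro s N
    have hN : (0 : ℝ) < (N : ℝ) + 1 := by positivity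
    have h := (hasSum_taylor_of_iteratedDeriv_nonneg hf hn (a := -((N : ℝ) + 1))
      (t := ((N : ℝ) + 1) * (Real.exp (s / ((N : ℝ) + 1)) - 1))
      (by nlinarith [Real.exp_pos (s / ((N : ℝ) + 1))])).div_const (f 0)
    refine h.congr_fun fun n => ?_
    -- The distance to the base point is a pure exponential times `N + 1`, so its powers produce
    -- `e^(s·n/(N+1))`.
    have h1 : ((N : ℝ) + 1) * (Real.exp (s / ((N : ℝ) + 1)) - 1) - -((N : ℝ) + 1) =
        ((N : ℝ) + 1) * Real.exp (s / ((N : ℝ) + 1)) := by ring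
    rw [h1, mul_pow, ← Real.exp_nat_mul]
    have h2 : (n : ℝ) * (s / ((N : ℝ) + 1)) = s * ((n : ℝ) / ((N : ℝ) + 1)) := by ring
    rw [h2]
    simp only [w]
    ring
  have hsum : ∀ N, HasSum (w N) 1 := fun N => by
    have := hexp 0 N
    simpa [div_self h0.ne'] using this
  have hF : ∀ s : ℝ, Tendsto (fun N : ℕ =>
      f (((N : ℝ) + 1) * (Real.exp (s / ((N : ℝ) + 1)) - 1)) / f 0) atTop (𝓝 (f s / f 0)) :=
    fun s => ((hf.continuous.tendsto s).comp (tendsto_mul_exp_div_sub_one s)).div_const _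
  let p : ℕ → ℕ → unitInterval := fun N n =>
    ⟨min ((n : ℝ) / ((N : ℝ) + 1)) 1, le_min (by positivity) zero_le_one, min_le_right _ _⟩
  have hsm : ∀ (s : ℝ) (N : ℕ), Summable fun n => w N n * Real.exp (s * (p N n : ℝ)) := by
    intro s N
    refine ((hsum N).summable.mul_right (Real.exp |s|)).of_nonneg_of_le
      (fun n => mul_nonneg (hw N n) (Real.exp_pos _).le) fun n => ?_
    refine mul_le_mul_of_nonneg_left (Real.exp_le_exp.2 ((le_abs_self _).trans ?_)) (hw N n)
    rw [abs_mul, abs_of_nonneg (p N n).2.1]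
    exact mul_le_of_le_one_right (abs_nonneg _) (p N n).2.2
  have hbound : ∀ (s k : ℝ), 0 < k → ∀ N : ℕ,
      |f (((N : ℝ) + 1) * (Real.exp (s / ((N : ℝ) + 1)) - 1)) / f 0 -
        ∑' n, w N n * Real.exp (s * (p N n : ℝ))| ≤ |s| / k * Real.exp (-k) *
          (f (((N : ℝ) + 1) * (Real.exp ((k + |s|) / ((N : ℝ) + 1)) - 1)) / f 0) := by
    intro s k hk N
    have h1 := (hexp s N).sub (hsm s N).hasSum
    have h2 := (hexp (k + |s|) N).mul_left (|s| / k * Real.exp (-k))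
    rw [← Real.norm_eq_abs]
    refine h1.norm_le_of_bounded h2 fun n => ?_
    rw [← mul_sub, norm_mul, Real.norm_of_nonneg (hw N n), Real.norm_eq_abs, mul_left_comm]
    exact mul_le_mul_of_nonneg_left (abs_exp_sub_exp_min_one_le hk s _) (hw N n)
  have hlim : ∀ s : ℝ, Tendsto (fun N => ∑' n, w N n * Real.exp (s * (p N n : ℝ))) atTop
      (𝓝 (f s / f 0)) := by
    intro s
    have hd : Tendsto (fun N : ℕ => f (((N : ℝ) + 1) * (Real.exp (s / ((N : ℝ) + 1)) - 1)) / f 0 -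
        ∑' n, w N n * Real.exp (s * (p N n : ℝ))) atTop (𝓝 0) := by
      rw [Metric.tendsto_nhds]
      intro ε hε
      -- Chosen so that the limiting error `|s| e^|s| / k` is below `ε`; the summand `1` keeps `k`
      -- positive when `s = 0`.
      let k : ℝ := |s| * Real.exp |s| / ε + 1
      have hk : 0 < k := by positivity
      have h1 := (hF (k + |s|)).const_mul (|s| / k * Real.exp (-k))
      have h2 : |s| / k * Real.exp (-k) * (f (k + |s|) / f 0) < ε := by
        have h3 : f (k + |s|) / f 0 ≤ Real.exp (k + |s|) := by
          rw [div_le_iff₀ h0, mul_comm]; exact hgrowth _ (by positivity)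
        calc _ ≤ |s| / k * Real.exp (-k) * Real.exp (k + |s|) := by gcongr
          _ = |s| * Real.exp |s| / k := by
              have : Real.exp (k + |s|) = Real.exp k * Real.exp |s| := Real.exp_add _ _
              rw [this, Real.exp_neg]; field_simp
          _ < ε := by
              rw [div_lt_iff₀ hk]
              simp only [k]
              field_simp
              linarith
      filter_upwards [h1.eventually_lt_const h2] with N hN
      rw [Real.dist_eq, sub_zero]
      exact (hbound s k hk N).trans_lt hN
    simpa using (hF s).sub hd
  obtain ⟨ν, hν, h⟩ := exists_probabilityMeasure_of_tendsto_tsum hw hsum hlim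
  refine ⟨ENNReal.ofReal (f 0) • ν, ⟨by simp⟩, fun t => ?_⟩
  rw [integral_smul_measure, ENNReal.toReal_ofReal h0.le, smul_eq_mul, ← h t]
  field_simp

/-! ### Functional calculus and order for Hermitian matrices. -/

section MatrixCalculus

open scoped MatrixOrder

variable {n : ℕ}

lemma continuousOn_real_spectrum (f : ℝ → ℝ) (A : Matrix (Fin n) (Fin n) ℂ) :
    ContinuousOn f (spectrum ℝ A) := A.finite_real_spectrum.continuousOn f

lemma Matrix.PosDef.pos_of_mem_spectrum {A : Matrix (Fin n) (Fin n) ℂ} (hA : A.PosDef) {x : ℝ}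
    (hx : x ∈ spectrum ℝ A) : 0 < x := by
  rw [hA.1.spectrum_real_eq_range_eigenvalues] at hx
  obtain ⟨i, rfl⟩ := hx
  exact hA.eigenvalues_pos i

lemma Matrix.PosSemidef.nonneg_of_mem_spectrum {A : Matrix (Fin n) (Fin n) ℂ}
    (hA : A.PosSemidef) {x : ℝ} (hx : x ∈ spectrum ℝ A) : 0 ≤ x := by
  rw [hA.1.spectrum_real_eq_range_eigenvalues] at hx
  obtain ⟨i, rfl⟩ := hx
  exact hA.eigenvalues_nonneg i

lemma cfc_isHermitian (f : ℝ → ℝ) (A : Matrix (Fin n) (Fin n) ℂ) : (cfc f A).IsHermitian :=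
  cfc_predicate (p := IsSelfAdjoint) f A

lemma Matrix.PosSemidef.cfc_sqrt_mul_self {A : Matrix (Fin n) (Fin n) ℂ} (hA : A.PosSemidef) :
    cfc Real.sqrt A * cfc Real.sqrt A = A := by
  have hs : IsSelfAdjoint A := hA.1
  rw [← cfc_mul _ _ A (continuousOn_real_spectrum _ A) (continuousOn_real_spectrum _ A)]
  conv_rhs => rw [← cfc_id ℝ A hs]
  exact cfc_congr fun x hx => Real.mul_self_sqrt (hA.nonneg_of_mem_spectrum hx)

lemma Matrix.PosDef.isUnit_cfc_sqrt {A : Matrix (Fin n) (Fin n) ℂ} (hA : A.PosDef) :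
    IsUnit (cfc Real.sqrt A) := by
  have h := hA.isUnit
  rw [← hA.posSemidef.cfc_sqrt_mul_self] at h
  exact isUnit_of_mul_isUnit_left h

/-- Spectra are finite, so the calculus of an arbitrary function reduces to that of an interpolating
polynomial, and no regularity is needed. -/
lemma exists_polynomial_eq_on {s : Set ℝ} (hs : s.Finite) (f : ℝ → ℝ) :
    ∃ q : Polynomial ℝ, ∀ x ∈ s, f x = q.eval x :=
  ⟨Lagrange.interpolate hs.toFinset id f, fun _ hx =>
    (Lagrange.eval_interpolate_at_node (s := hs.toFinset) (v := id) f Function.injective_id.injOn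
      (hs.mem_toFinset.2 hx)).symm⟩

lemma aeval_mul_eq_mul_aeval {X Y Z : Matrix (Fin n) (Fin n) ℂ} (h : X * Z = Z * Y)
    (q : Polynomial ℝ) : Polynomial.aeval X q * Z = Z * Polynomial.aeval Y q := by
  induction q using Polynomial.induction_on' with
  | add p q hp hq => simp only [map_add, add_mul, mul_add, hp, hq]
  | monomial k a =>
    have hk : X ^ k * Z = Z * Y ^ k := by
      induction k with
      | zero => simp
      | succ k ih => rw [pow_succ, mul_assoc, h, ← mul_assoc, ih, mul_assoc, ← pow_succ]
    simp only [Polynomial.aeval_monomial, mul_assoc, hk]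
    rw [← mul_assoc, ← mul_assoc, Algebra.commutes]

/-- The functional calculus respects intertwining relations. -/
lemma cfc_mul_eq_mul_cfc {X Y Z : Matrix (Fin n) (Fin n) ℂ} (hX : X.IsHermitian)
    (hY : Y.IsHermitian) (h : X * Z = Z * Y) (f : ℝ → ℝ) : cfc f X * Z = Z * cfc f Y := by
  -- The same polynomial has to interpolate `f` on both spectra.
  obtain ⟨q, hq⟩ := exists_polynomial_eq_on (X.finite_real_spectrum.union Y.finite_real_spectrum) f
  have hX' : IsSelfAdjoint X := hX
  have hY' : IsSelfAdjoint Y := hY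
  rw [cfc_congr (a := X) (g := q.eval) fun x hx => hq x (Or.inl hx),
    cfc_congr (a := Y) (g := q.eval) fun x hx => hq x (Or.inr hx), cfc_polynomial q X,
    cfc_polynomial q Y, aeval_mul_eq_mul_aeval h]

lemma cfc_inv_eq {Y : Matrix (Fin n) (Fin n) ℂ} (hY : Y.PosDef) (f : ℝ → ℝ) :
    cfc f Y⁻¹ * Y = cfc (fun x => x * f x⁻¹) Y := by
  have hs : IsSelfAdjoint Y := hY.1
  have h := cfc_comp_inv f hY.isUnit.unit
    ((Y.finite_real_spectrum.image _).continuousOn f) hs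
  rw [IsUnit.unit_spec, Matrix.coe_units_inv, IsUnit.unit_spec] at h
  rw [← h]
  nth_rewrite 2 [← cfc_id ℝ Y hs]
  rw [← cfc_mul _ _ Y (continuousOn_real_spectrum _ Y) (continuousOn_real_spectrum _ Y)]
  exact cfc_congr fun x _ => mul_comm _ _

/-- The functional calculus of a Hermitian matrix, entry by entry. -/
lemma cfc_apply_eq_sum {X : Matrix (Fin n) (Fin n) ℂ} (hX : X.IsHermitian) (f : ℝ → ℝ)
    (i j : Fin n) : cfc f X i j = ∑ k, (hX.eigenvectorUnitary : Matrix (Fin n) (Fin n) ℂ) i k *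
      (f (hX.eigenvalues k) : ℂ) *
        star ((hX.eigenvectorUnitary : Matrix (Fin n) (Fin n) ℂ) j k) := by
  rw [hX.cfc_eq, Matrix.IsHermitian.cfc, Unitary.conjStarAlgAut_apply, Matrix.mul_apply]
  refine Finset.sum_congr rfl fun k _ => ?_
  rw [Matrix.mul_diagonal]
  rfl

/-- Writing `D = S * S` with `S` Hermitian, the arithmetic-geometric inequality bounds the entry by
`(D i i + D j j) / 2`. Thus convergence of traces controls convergence of entries. -/
lemma Matrix.PosSemidef.norm_apply_le_trace {D : Matrix (Fin n) (Fin n) ℂ} (hD : D.PosSemidef)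
    (i j : Fin n) : ‖D i j‖ ≤ D.trace.re := by
  set S := cfc Real.sqrt D with hS
  have hSS : S * S = D := hD.cfc_sqrt_mul_self
  have hstar : ∀ k l, S k l = star (S l k) := fun k l =>
    ((cfc_isHermitian Real.sqrt D).apply k l).symm
  have hdiag : ∀ k, (D k k).re = ∑ l, ‖S k l‖ ^ 2 := by
    intro k
    rw [← hSS, Matrix.mul_apply, Complex.re_sum]
    refine Finset.sum_congr rfl fun l _ => ?_
    rw [hstar l k, Complex.star_def, Complex.mul_conj, Complex.ofReal_re, Complex.normSq_eq_norm_sq]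
  have htr : D.trace.re = ∑ k, (D k k).re := by
    simp [Matrix.trace, Complex.re_sum]
  have hle : ∀ k, (D k k).re ≤ D.trace.re := fun k => by
    rw [htr]
    exact Finset.single_le_sum (f := fun k => (D k k).re)
      (fun k _ => by rw [hdiag]; positivity) (Finset.mem_univ k)
  have h1 : ‖D i j‖ ≤ ∑ k, (‖S i k‖ ^ 2 + ‖S j k‖ ^ 2) / 2 := by
    conv_lhs => rw [← hSS, Matrix.mul_apply]
    refine (norm_sum_le _ _).trans (Finset.sum_le_sum fun k _ => ?_)
    rw [norm_mul, hstar k j, norm_star]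
    nlinarith [sq_nonneg (‖S i k‖ - ‖S j k‖)]
  rw [← Finset.sum_div, Finset.sum_add_distrib, ← hdiag, ← hdiag] at h1
  linarith [hle i, hle j]

/-- A positive family of matrices that decreases with its parameter converges. -/
lemma exists_tendsto_of_posSemidef_sub {M : ℝ → Matrix (Fin n) (Fin n) ℂ}
    (hpos : ∀ ε, 0 < ε → (M ε).PosSemidef)
    (hmono : ∀ ε δ, 0 < ε → ε ≤ δ → (M δ - M ε).PosSemidef) :
    ∃ L, Tendsto M (𝓝[>] 0) (𝓝 L) := by
  have hτm : MonotoneOn (fun ε => (M ε).trace.re) (Ioi 0) := by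
    intro ε hε δ _ hεδ
    have h := (Complex.le_def.1 (hmono ε δ hε hεδ).trace_nonneg).1
    simpa [Matrix.trace_sub] using h
  have hτ := hτm.tendsto_nhdsGT ⟨0, by
    rintro _ ⟨ε, hε, rfl⟩
    exact (Complex.le_def.1 (hpos ε hε).trace_nonneg).1⟩
  -- Differences along the family are semidefinite up to sign, so the convergent trace makes every
  -- entry Cauchy.
  have hdist : ∀ ε δ, 0 < ε → 0 < δ → ∀ i j,
      dist (M ε i j) (M δ i j) ≤ dist (M ε).trace.re (M δ).trace.re := by
    have key : ∀ ε δ, 0 < ε → ε ≤ δ → ∀ i j,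
        dist (M ε i j) (M δ i j) ≤ dist (M ε).trace.re (M δ).trace.re := by
      intro ε δ hε hεδ i j
      have h := (hmono ε δ hε hεδ).norm_apply_le_trace i j
      rw [dist_comm, dist_comm (M ε).trace.re, dist_eq_norm, Real.dist_eq]
      refine le_trans h ?_
      rw [Matrix.trace_sub, Complex.sub_re]
      exact le_abs_self _
    intro ε δ hε hδ i j
    rcases le_total ε δ with h | h
    · exact key ε δ hε h i j
    · rw [dist_comm, dist_comm (M ε).trace.re]; exact key δ ε hδ h i j
  have hent : ∀ i j, ∃ c, Tendsto (fun ε => M ε i j) (𝓝[>] 0) (𝓝 c) := by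
    intro i j
    rw [← cauchy_map_iff_exists_tendsto, Metric.cauchy_iff]
    refine ⟨inferInstance, fun r hr => ?_⟩
    obtain ⟨t, ht, htr⟩ := (Metric.cauchy_iff.1 hτ.cauchy_map).2 r hr
    have ht' : {ε | (M ε).trace.re ∈ t} ∩ Ioi 0 ∈ 𝓝[>] (0 : ℝ) :=
      inter_mem ht self_mem_nhdsWithin
    refine ⟨_, image_mem_map ht', ?_⟩
    rintro _ ⟨ε, ⟨h1, h2⟩, rfl⟩ _ ⟨δ, ⟨h3, h4⟩, rfl⟩
    exact (hdist ε δ h2 h4 i j).trans_lt (htr _ h1 _ h3)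
  choose c hc using hent
  exact ⟨c, tendsto_pi_nhds.2 fun i => tendsto_pi_nhds.2 fun j => hc i j⟩

section LownerHeinz

open scoped Matrix.Norms.L2Operator

/-- The Löwner–Heinz inequality for matrices. -/
lemma Matrix.PosSemidef.cfc_rpow_sub {A B : Matrix (Fin n) (Fin n) ℂ} (hA : A.PosSemidef)
    (hAB : (B - A).PosSemidef) {α : ℝ} (hα : α ∈ Icc (0 : ℝ) 1) :
    (cfc (fun x : ℝ => x ^ α) B - cfc (fun x : ℝ => x ^ α) A).PosSemidef := by
  have h1 : (0 : Matrix (Fin n) (Fin n) ℂ) ≤ A := hA.nonneg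
  have h2 : A ≤ B := hAB
  have h := CFC.rpow_le_rpow hα h2
  rw [CFC.rpow_eq_cfc_real h1, CFC.rpow_eq_cfc_real (h1.trans h2)] at h
  exact h

end LownerHeinz

end MatrixCalculus

/-! ### Operator means and mixtures of weighted geometric means. -/

section OperatorMeans

variable {n : ℕ}

lemma isHermitian_conj {S B : Matrix (Fin n) (Fin n) ℂ} (hS : S.IsHermitian)
    (hB : B.IsHermitian) : (S * B * S).IsHermitian := by
  have h := Matrix.isHermitian_conjTranspose_mul_mul S hB
  rwa [hS.eq] at h

lemma posDef_conj_inv_sqrt {A B : Matrix (Fin n) (Fin n) ℂ} (hA : A.PosDef) (hB : B.PosDef) :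
    ((cfc Real.sqrt A)⁻¹ * B * (cfc Real.sqrt A)⁻¹).PosDef := by
  have hS : (cfc Real.sqrt A)⁻¹.IsHermitian := (cfc_isHermitian _ A).inv
  have hu : IsUnit (cfc Real.sqrt A)⁻¹ := (Matrix.isUnit_nonsing_inv_iff).2 hA.isUnit_cfc_sqrt
  have h := (Matrix.IsUnit.posDef_star_left_conjugate_iff hu (x := B)).2 hB
  rwa [Matrix.star_eq_conjTranspose, hS.eq] at h

lemma posSemidef_conj {S D : Matrix (Fin n) (Fin n) ℂ} (hS : S.IsHermitian)
    (hD : D.PosSemidef) : (S * D * S).PosSemidef := by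
  have h := hD.conjTranspose_mul_mul_same S
  rwa [hS.eq] at h

/-- Transposition of an operator mean: swapping the arguments replaces `f` by `x f(1/x)`. -/
lemma posDefMean_swap {A B : Matrix (Fin n) (Fin n) ℂ} (hA : A.PosDef) (hB : B.PosDef)
    (f : ℝ → ℝ) : posDefMean f A B = posDefMean (fun x => x * f x⁻¹) B A := by
  have hY := posDef_conj_inv_sqrt hB hA
  have hX := posDef_conj_inv_sqrt hA hB
  unfold posDefMean
  rw [← cfc_inv_eq hY]
  have hSS := hA.posSemidef.cfc_sqrt_mul_self
  have hTT := hB.posSemidef.cfc_sqrt_mul_self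
  have hSu := (Matrix.isUnit_iff_isUnit_det _).1 hA.isUnit_cfc_sqrt
  have hTu := (Matrix.isUnit_iff_isUnit_det _).1 hB.isUnit_cfc_sqrt
  have hYu := (Matrix.isUnit_iff_isUnit_det _).1 hY.isUnit
  set S := cfc Real.sqrt A
  set T := cfc Real.sqrt B
  set X := S⁻¹ * B * S⁻¹ with hXdef
  set Y := T⁻¹ * A * T⁻¹ with hYdef
  have hST : S = S⁻¹ * T * (T⁻¹ * A) := by
    rw [mul_assoc, Matrix.mul_nonsing_inv_cancel_left _ _ hTu, ← hSS,
      Matrix.nonsing_inv_mul_cancel_left _ _ hSu]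
  have hYT : Y * T = T⁻¹ * A := by
    rw [hYdef, Matrix.nonsing_inv_mul_cancel_right _ _ hTu]
  -- `X` and `Y⁻¹` are similar through `Z = S⁻¹ * T`, which is generally not unitary; the
  -- intertwining lemma still carries `f` across.
  have hXZ : X * (S⁻¹ * T) = (S⁻¹ * T) * Y⁻¹ := by
    have h : X * (S⁻¹ * T) * Y = S⁻¹ * T := by
      rw [hXdef, hYdef, ← hSS, ← hTT]
      simp only [mul_assoc, Matrix.mul_nonsing_inv_cancel_left _ _ hTu,
        Matrix.nonsing_inv_mul_cancel_left _ _ hSu]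
      rw [Matrix.mul_nonsing_inv _ hTu, mul_one]
    rw [← h, Matrix.mul_nonsing_inv_cancel_right _ _ hYu, h]
  have hint := cfc_mul_eq_mul_cfc hX.1 hY.1.inv hXZ f
  calc S * cfc f X * S = S * cfc f X * (S⁻¹ * T * (T⁻¹ * A)) := by rw [← hST]
    _ = S * (cfc f X * (S⁻¹ * T)) * (T⁻¹ * A) := by simp only [mul_assoc]
    _ = T * (cfc f Y⁻¹ * Y) * T := by
      rw [hint, ← hYT]
      simp only [mul_assoc, Matrix.mul_nonsing_inv_cancel_left _ _ hSu]

lemma posDefMean_congr {A B : Matrix (Fin n) (Fin n) ℂ} (hA : A.PosDef) (hB : B.PosDef)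
    {f g : ℝ → ℝ} (h : ∀ x, 0 < x → f x = g x) : posDefMean f A B = posDefMean g A B := by
  unfold posDefMean
  rw [cfc_congr fun x hx => h x ((posDef_conj_inv_sqrt hA hB).pos_of_mem_spectrum hx)]

/-- Powers are closed under transposition, since `x * x^(-α) = x^(1-α)`. This turns monotonicity in
the second argument into monotonicity in the first. -/
lemma posDefMean_rpow_swap {A B : Matrix (Fin n) (Fin n) ℂ} (hA : A.PosDef) (hB : B.PosDef)
    (α : ℝ) : posDefMean (fun x => x ^ α) A B = posDefMean (fun x => x ^ (1 - α)) B A := by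
  rw [posDefMean_swap hA hB]
  refine posDefMean_congr hB hA fun x hx => ?_
  rw [Real.inv_rpow hx.le, Real.rpow_sub hx, Real.rpow_one, div_eq_mul_inv]

lemma posDefMean_rpow_mono_right {A B B' : Matrix (Fin n) (Fin n) ℂ} (hA : A.PosDef)
    (hB : B.PosDef) (hBB' : (B' - B).PosSemidef) {α : ℝ} (hα : α ∈ Icc (0 : ℝ) 1) :
    (posDefMean (fun x => x ^ α) A B' - posDefMean (fun x => x ^ α) A B).PosSemidef := by
  have hS := cfc_isHermitian Real.sqrt A
  unfold posDefMean
  rw [← sub_mul, ← mul_sub]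
  refine posSemidef_conj hS ((posDef_conj_inv_sqrt hA hB).posSemidef.cfc_rpow_sub ?_ hα)
  rw [← sub_mul, ← mul_sub]
  exact posSemidef_conj hS.inv hBB'

/-- Weighted geometric means are jointly monotone. -/
lemma posDefMean_rpow_mono {A A' B B' : Matrix (Fin n) (Fin n) ℂ} (hA : A.PosDef)
    (hA' : A'.PosDef) (hB : B.PosDef) (hB' : B'.PosDef) (hAA' : (A' - A).PosSemidef)
    (hBB' : (B' - B).PosSemidef) {α : ℝ} (hα : α ∈ Icc (0 : ℝ) 1) :
    (posDefMean (fun x => x ^ α) A' B' - posDefMean (fun x => x ^ α) A B).PosSemidef := by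
  have h1 := posDefMean_rpow_mono_right hA hB hBB' hα
  have h2 := posDefMean_rpow_mono_right hB' hA hAA' (α := 1 - α)
    ⟨by linarith [hα.2], by linarith [hα.1]⟩
  rw [← posDefMean_rpow_swap hA' hB', ← posDefMean_rpow_swap hA hB'] at h2
  simpa using h2.add h1

lemma posDefMean_posSemidef {A B : Matrix (Fin n) (Fin n) ℂ} (hA : A.PosDef) (hB : B.PosDef)
    {f : ℝ → ℝ} (hf : ∀ x, 0 < x → 0 ≤ f x) : (posDefMean f A B).PosSemidef := by
  refine posSemidef_conj (cfc_isHermitian _ _) ?_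
  open scoped MatrixOrder in
  exact Matrix.nonneg_iff_posSemidef.1 (cfc_nonneg fun x hx =>
    hf x ((posDef_conj_inv_sqrt hA hB).pos_of_mem_spectrum hx))

/-- The entries of a mean are linear combinations of values of the representing function. -/
lemma exists_posDefMean_apply_eq_sum {A B : Matrix (Fin n) (Fin n) ℂ} (hA : A.PosDef)
    (hB : B.PosDef) : ∃ (c : Fin n → Fin n → Fin n → ℂ) (x : Fin n → ℝ), (∀ k, 0 < x k) ∧
      ∀ (f : ℝ → ℝ) (i j : Fin n), posDefMean f A B i j = ∑ k, c i j k * (f (x k) : ℂ) := by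
  have hX := posDef_conj_inv_sqrt hA hB
  set S := cfc Real.sqrt A with hS
  -- The coefficients come from `S` and the eigenvectors, the nodes from the eigenvalues; neither
  -- depends on `f`, so questions about varying exponents become scalar.
  set V : Matrix (Fin n) (Fin n) ℂ := (hX.1.eigenvectorUnitary : Matrix (Fin n) (Fin n) ℂ)
  refine ⟨fun i j k => ∑ b, ∑ a, S i a * V a k * star (V b k) * S b j,
    hX.1.eigenvalues, fun k => hX.eigenvalues_pos k, fun f i j => ?_⟩
  change (S * cfc f (S⁻¹ * B * S⁻¹) * S) i j = _
  simp only [Matrix.mul_apply (M := S * cfc f (S⁻¹ * B * S⁻¹)), Matrix.mul_apply (M := S),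
    cfc_apply_eq_sum hX.1, Finset.sum_mul, Finset.mul_sum]
  conv_rhs => rw [Finset.sum_comm]
  refine Finset.sum_congr rfl fun b _ => ?_
  conv_rhs => rw [Finset.sum_comm]
  refine Finset.sum_congr rfl fun a _ => Finset.sum_congr rfl fun k _ => ?_
  ring

/-- The shifts by which means of positive semidefinite matrices are defined. -/
lemma Matrix.PosSemidef.posDef_add_smul_one {A : Matrix (Fin n) (Fin n) ℂ} (hA : A.PosSemidef)
    {ε : ℝ} (hε : 0 < ε) : (A + (ε : ℂ) • (1 : Matrix (Fin n) (Fin n) ℂ)).PosDef :=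
  (Matrix.PosDef.one.smul (by exact_mod_cast hε : (0 : ℂ) < ε)).posSemidef_add hA

lemma posSemidef_add_smul_one_sub (A : Matrix (Fin n) (Fin n) ℂ) {ε δ : ℝ} (h : ε ≤ δ) :
    (A + (δ : ℂ) • (1 : Matrix (Fin n) (Fin n) ℂ) -
      (A + (ε : ℂ) • (1 : Matrix (Fin n) (Fin n) ℂ))).PosSemidef := by
  rw [add_sub_add_left_eq_sub, ← sub_smul]
  refine Matrix.PosSemidef.one.smul ?_
  rw [← Complex.ofReal_sub]
  exact_mod_cast sub_nonneg.2 h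

/-- Joint monotonicity makes the shifted means decrease with `ε`, so the `limUnder` in the
definition is a genuine limit. -/
lemma tendsto_weightedGeometricMean {A B : Matrix (Fin n) (Fin n) ℂ} (hA : A.PosSemidef)
    (hB : B.PosSemidef) {α : ℝ} (hα : α ∈ Icc (0 : ℝ) 1) :
    Tendsto (fun ε : ℝ => posDefMean (fun x => x ^ α)
      (A + (ε : ℂ) • (1 : Matrix (Fin n) (Fin n) ℂ))
      (B + (ε : ℂ) • (1 : Matrix (Fin n) (Fin n) ℂ))) (𝓝[>] 0)
        (𝓝 (weightedGeometricMean α A B)) := by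
  refine tendsto_nhds_limUnder (exists_tendsto_of_posSemidef_sub (fun ε hε => ?_)
    fun ε δ hε hεδ => ?_)
  · exact posDefMean_posSemidef (hA.posDef_add_smul_one hε) (hB.posDef_add_smul_one hε)
      fun x hx => Real.rpow_nonneg hx.le _
  · exact posDefMean_rpow_mono (hA.posDef_add_smul_one hε)
      (hA.posDef_add_smul_one (hε.trans_le hεδ)) (hB.posDef_add_smul_one hε)
      (hB.posDef_add_smul_one (hε.trans_le hεδ)) (posSemidef_add_smul_one_sub A hεδ)
      (posSemidef_add_smul_one_sub B hεδ) hα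

lemma continuous_posDefMean_rpow {A B : Matrix (Fin n) (Fin n) ℂ} (hA : A.PosDef)
    (hB : B.PosDef) : Continuous fun α : unitInterval =>
      posDefMean (fun x => x ^ (α : ℝ)) A B := by
  obtain ⟨c, x, hx, h⟩ := exists_posDefMean_apply_eq_sum hA hB
  refine continuous_pi fun i => continuous_pi fun j => ?_
  simp only [h]
  refine continuous_finsetSum _ fun k _ => continuous_const.mul (Complex.continuous_ofReal.comp ?_)
  exact continuous_const.rpow continuous_subtype_val fun _ => Or.inl (hx k).ne'

lemma posDefMean_apply_eq_integral {A B : Matrix (Fin n) (Fin n) ℂ} (hA : A.PosDef)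
    (hB : B.PosDef) {h : ℝ → ℝ} {ν : Measure unitInterval} [IsFiniteMeasure ν]
    (hν : ∀ x : ℝ, 0 ≤ x → h x = ∫ l : unitInterval, x ^ (l : ℝ) ∂ν) (i j : Fin n) :
    posDefMean h A B i j =
      ∫ α : unitInterval, posDefMean (fun x => x ^ (α : ℝ)) A B i j ∂ν := by
  obtain ⟨c, x, hx, hc⟩ := exists_posDefMean_apply_eq_sum hA hB
  simp only [hc]
  rw [integral_finsetSum]
  · refine Finset.sum_congr rfl fun k _ => ?_
    rw [integral_const_mul, integral_complex_ofReal, hν _ (hx k).le]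
  · intro k _
    refine Continuous.integrable_of_hasCompactSupport ?_ (HasCompactSupport.of_compactSpace _)
    refine continuous_const.mul (Complex.continuous_ofReal.comp ?_)
    exact continuous_const.rpow continuous_subtype_val fun _ => Or.inl (hx k).ne'

/-- A mixture of power functions represents the mixture of weighted geometric means. -/
theorem operatorMean_apply_eq_integral {A B : Matrix (Fin n) (Fin n) ℂ} (hA : A.PosSemidef)
    (hB : B.PosSemidef) {h : ℝ → ℝ} {ν : Measure unitInterval} [IsFiniteMeasure ν]
    (hν : ∀ x : ℝ, 0 ≤ x → h x = ∫ l : unitInterval, x ^ (l : ℝ) ∂ν) (i j : Fin n) :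
    Integrable (fun α : unitInterval => weightedGeometricMean (α : ℝ) A B i j) ν ∧
      operatorMean h A B i j = ∫ α : unitInterval, weightedGeometricMean (α : ℝ) A B i j ∂ν := by
  let As : ℝ → Matrix (Fin n) (Fin n) ℂ := fun ε => A + (ε : ℂ) • 1
  let Bs : ℝ → Matrix (Fin n) (Fin n) ℂ := fun ε => B + (ε : ℂ) • 1
  have hAs : ∀ {ε : ℝ}, 0 < ε → (As ε).PosDef := fun hε => hA.posDef_add_smul_one hε
  have hBs : ∀ {ε : ℝ}, 0 < ε → (Bs ε).PosDef := fun hε => hB.posDef_add_smul_one hε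
  -- Shifted means increase with `ε`, so the trace at `ε = 1` dominates every entry for `0 < ε ≤ 1`.
  let bound : unitInterval → ℝ := fun α =>
    (posDefMean (fun x => x ^ (α : ℝ)) (As 1) (Bs 1)).trace.re
  have hbc : Continuous bound :=
    Complex.continuous_re.comp
      (continuous_posDefMean_rpow (hAs one_pos) (hBs one_pos)).matrix_trace
  have hbi : Integrable bound ν :=
    hbc.integrable_of_hasCompactSupport (HasCompactSupport.of_compactSpace _)
  have hbd : ∀ ε : ℝ, 0 < ε → ε ≤ 1 → ∀ (α : unitInterval) (i j : Fin n),
      ‖posDefMean (fun x => x ^ (α : ℝ)) (As ε) (Bs ε) i j‖ ≤ bound α := by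
    intro ε hε hε1 α i j
    have h1 := (posDefMean_posSemidef (hAs hε) (hBs hε) (f := fun x => x ^ (α : ℝ))
      fun x hx => Real.rpow_nonneg hx.le _).norm_apply_le_trace i j
    have h2 := (posDefMean_rpow_mono (hAs hε) (hAs one_pos) (hBs hε) (hBs one_pos)
      (posSemidef_add_smul_one_sub A hε1) (posSemidef_add_smul_one_sub B hε1) α.2).trace_nonneg
    have h3 := (Complex.le_def.1 h2).1
    rw [Matrix.trace_sub, Complex.sub_re, Complex.zero_re] at h3
    simp only [bound]
    linarith
  have hent : ∀ (α : unitInterval) (i j : Fin n), Tendsto (fun ε : ℝ =>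
      posDefMean (fun x => x ^ (α : ℝ)) (As ε) (Bs ε) i j) (𝓝[>] 0)
        (𝓝 (weightedGeometricMean (α : ℝ) A B i j)) := fun α i j =>
    tendsto_pi_nhds.1 (tendsto_pi_nhds.1 (tendsto_weightedGeometricMean hA hB α.2) i) j
  have hev : ∀ᶠ ε in 𝓝[>] (0 : ℝ), 0 < ε ∧ ε ≤ 1 := by
    filter_upwards [Ioc_mem_nhdsGT (zero_lt_one' ℝ)] with ε hε using hε
  have hmeas : ∀ {ε : ℝ}, 0 < ε → ∀ i j, AEStronglyMeasurable (fun α : unitInterval =>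
      posDefMean (fun x => x ^ (α : ℝ)) (As ε) (Bs ε) i j) ν := fun hε i j =>
    ((continuous_posDefMean_rpow (hAs hε) (hBs hε)).matrix_elem i j).aestronglyMeasurable
  have hlim : ∀ i j, Tendsto (fun ε : ℝ => posDefMean h (As ε) (Bs ε) i j) (𝓝[>] 0)
      (𝓝 (∫ α : unitInterval, weightedGeometricMean (α : ℝ) A B i j ∂ν)) := by
    intro i j
    have h1 : Tendsto (fun ε : ℝ => ∫ α : unitInterval,
        posDefMean (fun x => x ^ (α : ℝ)) (As ε) (Bs ε) i j ∂ν) (𝓝[>] 0)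
          (𝓝 (∫ α : unitInterval, weightedGeometricMean (α : ℝ) A B i j ∂ν)) := by
      refine tendsto_integral_filter_of_dominated_convergence bound ?_ ?_ hbi
        (Eventually.of_forall fun α => hent α i j)
      · filter_upwards [hev] with ε hε using hmeas hε.1 i j
      · filter_upwards [hev] with ε hε using Eventually.of_forall fun α => hbd ε hε.1 hε.2 α i j
    refine h1.congr' ?_
    filter_upwards [hev] with ε hε
    exact (posDefMean_apply_eq_integral (hAs hε.1) (hBs hε.1) hν i j).symm
  constructor
  -- Measurability in `α` passes to the limit along a sequence of positive shifts, where the means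
  -- are continuous in `α`.
  · have hu : Tendsto (fun k : ℕ => 1 / ((k : ℝ) + 1)) atTop (𝓝[>] 0) :=
      tendsto_nhdsWithin_iff.2 ⟨tendsto_one_div_add_atTop_nhds_zero_nat,
        Eventually.of_forall fun k => mem_Ioi.2 Nat.one_div_pos_of_nat⟩
    refine hbi.mono' (aestronglyMeasurable_of_tendsto_ae atTop
      (fun k : ℕ => hmeas (Nat.one_div_pos_of_nat (n := k)) i j)
      (Eventually.of_forall fun α => (hent α i j).comp hu)) (Eventually.of_forall fun α => ?_)
    refine le_of_tendsto (hent α i j).norm ?_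
    filter_upwards [hev] with ε hε using hbd ε hε.1 hε.2 α i j
  · have h1 : Tendsto (fun ε : ℝ => posDefMean h (As ε) (Bs ε)) (𝓝[>] 0)
        (𝓝 (Matrix.of fun i j => ∫ α : unitInterval, weightedGeometricMean (α : ℝ) A B i j ∂ν)) :=
      tendsto_pi_nhds.2 fun i => tendsto_pi_nhds.2 fun j => hlim i j
    exact congrFun (congrFun h1.limUnder_eq i) j

end OperatorMeans

/-! ### Linear growth of `h` and means of matrices of order one. -/

section Scalars

lemma isHermitian_diagonal_ofReal {n : ℕ} (d : Fin n → ℝ) :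
    (Matrix.diagonal fun i => (d i : ℂ)).IsHermitian := by
  rw [Matrix.isHermitian_diagonal_iff]
  intro i
  simp [IsSelfAdjoint]

lemma aeval_diagonal_ofReal {n : ℕ} (d : Fin n → ℝ) (q : Polynomial ℝ) :
    Polynomial.aeval (Matrix.diagonal fun i => (d i : ℂ)) q =
      Matrix.diagonal fun i => ((q.eval (d i) : ℝ) : ℂ) := by
  induction q using Polynomial.induction_on' with
  | add p q hp hq => simp [hp, hq, Matrix.diagonal_add]
  | monomial k a =>
    rw [Polynomial.aeval_monomial, Matrix.diagonal_pow, Matrix.algebraMap_eq_diagonal,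
      Matrix.diagonal_mul_diagonal]
    congr 1
    ext i
    simp

lemma cfc_diagonal_ofReal {n : ℕ} (f : ℝ → ℝ) (d : Fin n → ℝ) :
    cfc f (Matrix.diagonal fun i => (d i : ℂ)) = Matrix.diagonal fun i => (f (d i) : ℂ) := by
  have hs : IsSelfAdjoint (Matrix.diagonal fun i => (d i : ℂ)) := isHermitian_diagonal_ofReal d
  obtain ⟨q, hq⟩ := exists_polynomial_eq_on
    ((Matrix.finite_real_spectrum (A := Matrix.diagonal fun i => (d i : ℂ))).union
      (finite_range d)) f
  rw [cfc_congr (g := q.eval) fun x hx => hq x (Or.inl hx), cfc_polynomial q _ hs,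
    aeval_diagonal_ofReal]
  congr 1
  ext i
  rw [hq _ (Or.inr (mem_range_self i))]

lemma posSemidef_diagonal_ofReal {n : ℕ} {d : Fin n → ℝ} (hd : ∀ i, 0 ≤ d i) :
    (Matrix.diagonal fun i => (d i : ℂ)).PosSemidef :=
  Matrix.PosSemidef.diagonal fun i => Complex.zero_le_real.2 (hd i)

/-- An operator monotone function is monotone. -/
lemma OperatorMonotone.monotoneOn {h : ℝ → ℝ} (hmono : OperatorMonotone h) :
    MonotoneOn h (Ici 0) := by
  intro x hx y hy hxy
  have h1 := hmono 1 _ _ (posSemidef_diagonal_ofReal (d := fun _ => x) fun _ => hx)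
    (posSemidef_diagonal_ofReal (d := fun _ => y) fun _ => hy) (by
      rw [Matrix.diagonal_sub]
      simpa using posSemidef_diagonal_ofReal (n := 1) (d := fun _ => y - x)
        fun _ => sub_nonneg.2 hxy)
  rw [cfc_diagonal_ofReal, cfc_diagonal_ofReal] at h1
  have h2 := h1.diag_nonneg (i := 0)
  simp only [Matrix.sub_apply, Matrix.diagonal_apply_eq, sub_nonneg] at h2
  exact_mod_cast h2

/-- Jensen-type inequality from the comparison of a multiple of a projection with a diagonal
matrix of order two. -/
lemma OperatorMonotone.mul_add_mul_le {h : ℝ → ℝ} (hmono : OperatorMonotone h) {a p : ℝ}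
    (ha : 0 ≤ a) (hp0 : 0 ≤ p) (hp1 : p ≤ 1) (hap : a * p < 1) :
    p * h a + (1 - p) * h 0 ≤ h 1 := by
  set c := √p
  set s := √(1 - p)
  set r := √(1 - a * p)
  have hc : c * c = p := Real.mul_self_sqrt hp0
  have hs : s * s = 1 - p := Real.mul_self_sqrt (by linarith)
  have hr : r * r = 1 - a * p := Real.mul_self_sqrt (by linarith)
  have hrpos : 0 < r := Real.sqrt_pos.2 (by linarith)
  let U : Matrix (Fin 2) (Fin 2) ℂ := !![(c : ℂ), -(s : ℂ); (s : ℂ), (c : ℂ)]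
  let d : Fin 2 → ℝ := ![a, 0]
  -- The second entry is the least one making the difference semidefinite: its determinant vanishes,
  -- so the difference is the rank-one matrix of `v`.
  let b : Fin 2 → ℝ := ![1, a * (1 - p) / (1 - a * p)]
  have hcs : (c : ℂ) * c + s * s = 1 := by
    norm_cast; rw [hc, hs]; ring
  have hstar : ∀ i j, star (U i j) = U i j := fun i j => by
    fin_cases i <;> fin_cases j <;> simp [U]
  have hUU : U.conjTranspose * U = 1 := by
    ext i j
    rw [Matrix.mul_apply, Fin.sum_univ_two, Matrix.conjTranspose_apply,
      Matrix.conjTranspose_apply, hstar, hstar]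
    fin_cases i <;> fin_cases j <;> simp [U]
    · exact hcs
    · ring
    · ring
    · linear_combination hcs
  have hconj : ∀ (e : Fin 2 → ℝ) (i j : Fin 2),
      (U * (Matrix.diagonal fun k => (e k : ℂ)) * U.conjTranspose) i j =
        U i 0 * e 0 * U j 0 + U i 1 * e 1 * U j 1 := fun e i j => by
    rw [Matrix.mul_apply, Fin.sum_univ_two, Matrix.conjTranspose_apply,
      Matrix.conjTranspose_apply, Matrix.mul_diagonal, Matrix.mul_diagonal, hstar, hstar]
  have hUU' : U * U.conjTranspose = 1 := mul_eq_one_comm.1 hUU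
  set D : Matrix (Fin 2) (Fin 2) ℂ := Matrix.diagonal fun i => (d i : ℂ) with hD
  have hDpos : D.PosSemidef := posSemidef_diagonal_ofReal fun i => by
    fin_cases i <;> simp [d, ha]
  have hA : (U * D * U.conjTranspose).PosSemidef := hDpos.mul_mul_conjTranspose_same U
  have hB : (Matrix.diagonal fun i => (b i : ℂ)).PosSemidef :=
    posSemidef_diagonal_ofReal fun i => by
      fin_cases i
      · simp [b]
      · exact div_nonneg (mul_nonneg ha (by linarith)) (by linarith)
  let v : Fin 2 → ℂ := ![(r : ℂ), ((-(a * c * s) / r : ℝ) : ℂ)]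
  have hBA : (Matrix.diagonal fun i => (b i : ℂ)) - U * D * U.conjTranspose =
      Matrix.vecMulVec v (star v) := by
    have e00 : 1 - c * a * c = r * r := by rw [hr]; linear_combination -a * hc
    have e01 : -(c * a * s) = r * (-(a * c * s) / r) := by field_simp
    have e11 : a * (1 - p) / (1 - a * p) - s * a * s =
        (-(a * c * s) / r) * (-(a * c * s) / r) := by
      have : (-(a * c * s) / r) * (-(a * c * s) / r) =
          a * a * (c * c) * (s * s) / (r * r) := by field_simp
      have h' : 1 - a * p ≠ 0 := by linarith
      have h'' : s * a * s = a * (1 - p) := by linear_combination a * hs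
      rw [this, hc, hs, hr, h'']
      field_simp
      ring
    have e10 : -(s * a * c) = (-(a * c * s) / r) * r := by field_simp
    ext i j
    rw [Matrix.sub_apply, hD, hconj, Matrix.vecMulVec_apply, Pi.star_apply]
    fin_cases i <;> fin_cases j <;> simp [U, d, b, v]
    · exact_mod_cast e00
    · exact_mod_cast e01
    · exact_mod_cast e10
    · exact_mod_cast e11
  have h1 := hmono 2 _ _ hA hB (by
    rw [hBA]; exact Matrix.posSemidef_vecMulVec_self_star v)
  have hint := cfc_mul_eq_mul_cfc hA.1 hDpos.1 (Z := U)
    (by rw [mul_assoc, hUU, mul_one]) h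
  have hcfc : cfc h (U * D * U.conjTranspose) =
      U * (Matrix.diagonal fun i => (h (d i) : ℂ)) * U.conjTranspose := by
    rw [← cfc_diagonal_ofReal, ← hD, ← hint, mul_assoc _ U, hUU', mul_one]
  rw [hcfc, cfc_diagonal_ofReal] at h1
  -- Only the corner entry matters: the value of `h` at the second entry of `b` never appears there.
  have h2 := h1.diag_nonneg (i := 0)
  rw [Matrix.sub_apply, hconj fun i => h (d i)] at h2
  simp [U, d, b] at h2
  have h3 : c * h a * c + s * h 0 * s ≤ h 1 := by exact_mod_cast h2
  calc p * h a + (1 - p) * h 0 = c * h a * c + s * h 0 * s := by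
        rw [← hc, show 1 - c * c = s * s by rw [hs, hc]]; ring
    _ ≤ h 1 := h3

/-- A non-negative operator monotone function has at most linear growth. -/
lemma OperatorMonotone.le_mul {h : ℝ → ℝ} (hmono : OperatorMonotone h)
    (hnonneg : ∀ x : ℝ, 0 ≤ x → 0 ≤ h x) {a : ℝ} (ha : 1 ≤ a) : h a ≤ h 1 * a := by
  have key : ∀ ε ∈ Ioo (0 : ℝ) 1, (1 - ε) * h a ≤ h 1 * a := by
    intro ε hε
    have h1 : a * ((1 - ε) / a) = 1 - ε := by field_simp
    -- The natural weight `1 / a` violates the strict condition `a * p < 1`, hence the factor `1 -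
    -- ε`, removed at the end.
    have h2 := hmono.mul_add_mul_le (a := a) (p := (1 - ε) / a) (by linarith)
      (div_nonneg (by linarith [hε.2]) (by linarith))
      ((div_le_one (by linarith)).2 (by linarith [hε.1])) (by rw [h1]; linarith [hε.1])
    have h3 : 0 ≤ (1 - (1 - ε) / a) * h 0 :=
      mul_nonneg (sub_nonneg.2 ((div_le_one (by linarith)).2 (by linarith [hε.1])))
        (hnonneg 0 le_rfl)
    have h4 : (1 - ε) / a * h a ≤ h 1 := by linarith
    rw [div_mul_eq_mul_div, div_le_iff₀ (by linarith)] at h4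
    exact h4
  have hc : Continuous fun ε : ℝ => (1 - ε) * h a := by fun_prop
  have ht := (hc.tendsto 0).mono_left (nhdsWithin_le_nhds (s := Ioi 0))
  rw [sub_zero, one_mul] at ht
  refine le_of_tendsto ht ?_
  filter_upwards [Ioo_mem_nhdsGT (zero_lt_one' ℝ)] with ε hε using key ε hε

lemma posDefMean_diagonal (h : ℝ → ℝ) {a b : ℝ} (ha : 0 < a) :
    posDefMean h (Matrix.diagonal fun _ : Fin 1 => (a : ℂ))
      (Matrix.diagonal fun _ : Fin 1 => (b : ℂ)) =
        Matrix.diagonal fun _ : Fin 1 => ((a * h (b / a) : ℝ) : ℂ) := by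
  have hs : √a * √a = a := Real.mul_self_sqrt ha.le
  have hs0 : √a ≠ 0 := (Real.sqrt_pos.2 ha).ne'
  have hinv : (Matrix.diagonal fun _ : Fin 1 => (√a : ℂ))⁻¹ =
      Matrix.diagonal fun _ : Fin 1 => (((√a)⁻¹ : ℝ) : ℂ) := by
    refine Matrix.inv_eq_right_inv ?_
    rw [Matrix.diagonal_mul_diagonal, ← Matrix.diagonal_one]
    congr 1
    ext i
    rw [← Complex.ofReal_mul, mul_inv_cancel₀ hs0, Complex.ofReal_one]
  have hmul : ∀ x y : ℝ, (Matrix.diagonal fun _ : Fin 1 => (x : ℂ)) *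
      (Matrix.diagonal fun _ : Fin 1 => (y : ℂ)) =
        Matrix.diagonal fun _ : Fin 1 => ((x * y : ℝ) : ℂ) := fun x y => by
    simp [Matrix.diagonal_mul_diagonal]
  unfold posDefMean
  rw [cfc_diagonal_ofReal, hinv, hmul, hmul, cfc_diagonal_ofReal, hmul, hmul]
  have h1 : (√a)⁻¹ * b * (√a)⁻¹ = b / a := by
    rw [div_eq_mul_inv]
    nth_rewrite 3 [← hs]
    rw [mul_inv]
    ring
  have h2 : √a * h (b / a) * √a = a * h (b / a) := by
    linear_combination h (b / a) * hs
  rw [h1, h2]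

/-- Operator means of matrices of order one. -/
lemma operatorMean_diagonal {h : ℝ → ℝ} {x L : ℝ}
    (hL : Tendsto (fun ε : ℝ => h ((x + ε) / (1 + ε))) (𝓝[>] 0) (𝓝 L)) :
    operatorMean h (Matrix.diagonal fun _ : Fin 1 => ((1 : ℝ) : ℂ))
      (Matrix.diagonal fun _ : Fin 1 => (x : ℂ)) 0 0 = L := by
  have h0 : Tendsto (fun ε : ℝ => 1 + ε) (𝓝[>] 0) (𝓝 1) := by
    have hc : Continuous fun ε : ℝ => 1 + ε := by fun_prop
    simpa using (hc.tendsto 0).mono_left (nhdsWithin_le_nhds (s := Ioi 0))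
  have h1 := h0.mul hL
  rw [one_mul] at h1
  have h2 : Tendsto (fun ε : ℝ => Matrix.diagonal fun _ : Fin 1 =>
      (((1 + ε) * h ((x + ε) / (1 + ε)) : ℝ) : ℂ)) (𝓝[>] 0)
        (𝓝 (Matrix.diagonal fun _ : Fin 1 => (L : ℂ))) := by
    have hc : Continuous fun y : ℝ => Matrix.diagonal fun _ : Fin 1 => (y : ℂ) :=
      (continuous_pi fun _ => Complex.continuous_ofReal).matrix_diagonal
    exact (hc.tendsto L).comp h1
  have h3 : Tendsto (fun ε : ℝ => posDefMean h
      ((Matrix.diagonal fun _ : Fin 1 => ((1 : ℝ) : ℂ)) + (ε : ℂ) • 1)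
      ((Matrix.diagonal fun _ : Fin 1 => (x : ℂ)) + (ε : ℂ) • 1)) (𝓝[>] 0)
        (𝓝 (Matrix.diagonal fun _ : Fin 1 => (L : ℂ))) := by
    refine h2.congr' ?_
    filter_upwards [self_mem_nhdsWithin] with ε hε
    have hadd : ∀ y : ℝ, (Matrix.diagonal fun _ : Fin 1 => (y : ℂ)) + (ε : ℂ) • 1 =
        Matrix.diagonal fun _ : Fin 1 => ((y + ε : ℝ) : ℂ) := fun y => by
      rw [← Matrix.diagonal_one, ← Matrix.diagonal_smul, Matrix.diagonal_add]
      simp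
    rw [hadd, hadd, posDefMean_diagonal h (add_pos one_pos hε)]
  rw [operatorMean, h3.limUnder_eq, Matrix.diagonal_apply_eq]

lemma tendsto_shift_div (x : ℝ) :
    Tendsto (fun ε : ℝ => (x + ε) / (1 + ε)) (𝓝[>] 0) (𝓝 x) := by
  have hc : ContinuousAt (fun ε : ℝ => (x + ε) / (1 + ε)) 0 :=
    ContinuousAt.div (by fun_prop) (by fun_prop) (by norm_num)
  simpa using hc.tendsto.mono_left (nhdsWithin_le_nhds (s := Ioi 0))

lemma weightedGeometricMean_diagonal {x α : ℝ} (hα : 0 ≤ α) :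
    weightedGeometricMean α (Matrix.diagonal fun _ : Fin 1 => ((1 : ℝ) : ℂ))
      (Matrix.diagonal fun _ : Fin 1 => (x : ℂ)) 0 0 = ((x ^ α : ℝ) : ℂ) :=
  operatorMean_diagonal
    (((Real.continuous_rpow_const hα).tendsto x).comp (tendsto_shift_div x))

/-! ### Regularity of mixtures of powers. -/

section Mixtures

variable {ν : Measure unitInterval}

/-- A mixture of power functions is continuous on the half-line. -/
lemma continuousOn_integral_rpow [IsFiniteMeasure ν] :
    ContinuousOn (fun x : ℝ => ∫ l : unitInterval, x ^ (l : ℝ) ∂ν) (Ici 0) := by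
  intro x hx
  -- For `y < x + 1` the bound follows from `y^l ≤ (1 + y)^l ≤ 1 + y`; enlarging the base covers `y
  -- < 1`.
  refine continuousWithinAt_of_dominated (bound := fun _ => 2 + x)
    (Eventually.of_forall fun y =>
      (measurable_const.pow measurable_subtype_coe).aestronglyMeasurable) ?_
    (integrable_const _) (Eventually.of_forall fun l =>
      (Real.continuous_rpow_const l.2.1).continuousWithinAt)
  have h1 : ∀ᶠ y in 𝓝[Ici 0] x, y < x + 1 :=
    nhdsWithin_le_nhds (Iio_mem_nhds (by linarith))
  filter_upwards [h1, self_mem_nhdsWithin] with y hy hy0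
  have hy0' : 0 ≤ y := hy0
  refine Eventually.of_forall fun l => ?_
  rw [Real.norm_of_nonneg (Real.rpow_nonneg hy0' _)]
  calc y ^ (l : ℝ) ≤ (1 + y) ^ (l : ℝ) := Real.rpow_le_rpow hy0' (by linarith) l.2.1
    _ ≤ (1 + y) ^ (1 : ℝ) := Real.rpow_le_rpow_of_exponent_le (by linarith) l.2.2
    _ ≤ 2 + x := by rw [Real.rpow_one]; linarith

/-- Identifies the mixture with a moment generating function, whose smoothness and derivatives are
known. -/
lemma integral_exp_rpow (t : ℝ) :
    ∫ l : unitInterval, Real.exp t ^ (l : ℝ) ∂ν =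
      ProbabilityTheory.mgf (fun l : unitInterval => (l : ℝ)) ν t := by
  unfold ProbabilityTheory.mgf
  refine integral_congr_ae (Eventually.of_forall fun l => ?_)
  simp only
  rw [← Real.exp_mul]

lemma integrableExpSet_unitInterval [IsFiniteMeasure ν] :
    ProbabilityTheory.integrableExpSet (fun l : unitInterval => (l : ℝ)) ν = univ :=
  eq_univ_of_forall fun t => by
    have hc : Continuous fun l : unitInterval => Real.exp (t * (l : ℝ)) := by fun_prop
    exact hc.integrable_of_hasCompactSupport (HasCompactSupport.of_compactSpace _)

lemma contDiff_mgf_unitInterval [IsFiniteMeasure ν] :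
    ContDiff ℝ ∞ (ProbabilityTheory.mgf (fun l : unitInterval => (l : ℝ)) ν) := by
  have h := ProbabilityTheory.analyticOnNhd_mgf (X := fun l : unitInterval => (l : ℝ)) (μ := ν)
  rw [integrableExpSet_unitInterval, interior_univ] at h
  exact (contDiffOn_univ.1 (h.contDiffOn uniqueDiffOn_univ))

lemma iteratedDeriv_mgf_unitInterval_nonneg [IsFiniteMeasure ν] (n : ℕ) (t : ℝ) :
    0 ≤ iteratedDeriv n (ProbabilityTheory.mgf (fun l : unitInterval => (l : ℝ)) ν) t := by
  rw [ProbabilityTheory.iteratedDeriv_mgf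
    (by rw [integrableExpSet_unitInterval, interior_univ]; trivial)]
  exact integral_nonneg fun l => mul_nonneg (pow_nonneg l.2.1 _) (Real.exp_pos _).le

end Mixtures

/-! ### Recovering `h` from its mean; forms of absolute monotonicity. -/

/-- A non-negative operator monotone function whose mean is a mixture of weighted geometric means
is the same mixture of power functions. -/
lemma eq_integral_rpow_of_operatorMean {h : ℝ → ℝ} (hm : MonotoneOn h (Ici 0))
    (hcont : ContinuousWithinAt h (Ici 0) 0) (h1 : h 1 = 1) {ν : Measure unitInterval}
    [IsProbabilityMeasure ν]
    (hν : ∀ x : ℝ, 0 ≤ x → operatorMean h (Matrix.diagonal fun _ : Fin 1 => ((1 : ℝ) : ℂ))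
      (Matrix.diagonal fun _ : Fin 1 => (x : ℂ)) 0 0 =
        ∫ α : unitInterval, weightedGeometricMean (α : ℝ)
          (Matrix.diagonal fun _ : Fin 1 => ((1 : ℝ) : ℂ))
          (Matrix.diagonal fun _ : Fin 1 => (x : ℂ)) 0 0 ∂ν) {x : ℝ} (hx : 0 ≤ x) :
    h x = ∫ l : unitInterval, x ^ (l : ℝ) ∂ν := by
  set g : ℝ → ℝ := fun x => ∫ l : unitInterval, x ^ (l : ℝ) ∂ν
  have hg : ContinuousOn g (Ici 0) := continuousOn_integral_rpow
  -- Continuity of `h` is not assumed away from `0`, so the mean only identifies limits along the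
  -- shifts with `g`.
  have hgL : ∀ {x L : ℝ}, 0 ≤ x →
      Tendsto (fun ε : ℝ => h ((x + ε) / (1 + ε))) (𝓝[>] 0) (𝓝 L) → L = g x := by
    intro x L hx hL
    have h2 := hν x hx
    rw [operatorMean_diagonal hL] at h2
    have h3 : ∀ α : unitInterval, weightedGeometricMean (α : ℝ)
        (Matrix.diagonal fun _ : Fin 1 => ((1 : ℝ) : ℂ))
        (Matrix.diagonal fun _ : Fin 1 => (x : ℂ)) 0 0 = ((x ^ (α : ℝ) : ℝ) : ℂ) :=
      fun α => weightedGeometricMean_diagonal α.2.1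
    simp only [h3, integral_complex_ofReal] at h2
    exact_mod_cast h2
  have hdiff : ∀ x ε δ : ℝ, 0 < ε → 0 < δ →
      (x + δ) / (1 + δ) - (x + ε) / (1 + ε) = (1 - x) * (δ - ε) / ((1 + δ) * (1 + ε)) := by
    intro x ε δ hε hδ
    field_simp
    ring
  have hx' : ∀ x ε : ℝ, 0 < ε → (x + ε) / (1 + ε) - x = (1 - x) * ε / (1 + ε) := by
    intro x ε hε
    field_simp
    ring
  have hu0 : ∀ {x ε : ℝ}, 0 ≤ x → 0 < ε → 0 ≤ (x + ε) / (1 + ε) := fun hx hε => by positivity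
  -- Below `1` the shifted ratio tends to `x` from the right, so `g x` is the right limit of `h`.
  have hlt : ∀ x, 0 ≤ x → x < 1 → h x ≤ g x ∧ ∀ y, x < y → g x ≤ h y := by
    intro x hx hx1
    have hge : ∀ ε ∈ Ioi (0 : ℝ), h x ≤ h ((x + ε) / (1 + ε)) := fun ε hε => by
      have hε' : 0 < ε := hε
      refine hm hx (hu0 hx hε) (sub_nonneg.1 ?_)
      rw [hx' x ε hε]
      exact div_nonneg (mul_nonneg (by linarith) hε'.le) (by linarith)
    have hmon : MonotoneOn (fun ε : ℝ => h ((x + ε) / (1 + ε))) (Ioi 0) := by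
      intro ε hε δ hδ hεδ
      have hε' : 0 < ε := hε
      have hδ' : 0 < δ := hδ
      refine hm (hu0 hx hε) (hu0 hx hδ) (sub_nonneg.1 ?_)
      rw [hdiff x ε δ hε hδ]
      exact div_nonneg (mul_nonneg (by linarith) (by linarith)) (by positivity)
    have hL := hmon.tendsto_nhdsGT ⟨h x, by rintro _ ⟨ε, hε, rfl⟩; exact hge ε hε⟩
    rw [hgL hx hL] at hL
    refine ⟨ge_of_tendsto hL (eventually_nhdsWithin_of_forall hge), fun y hy => ?_⟩
    refine le_of_tendsto hL ?_
    filter_upwards [(tendsto_shift_div x).eventually_lt_const hy, self_mem_nhdsWithin] with ε h2 h3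
    exact hm (hu0 hx h3) (hx.trans hy.le) h2.le
  -- Above `1` the ratio tends to `x` from the left, so `g x` is the left limit of `h`.
  have hgt : ∀ x, 1 < x → g x ≤ h x ∧ ∀ y, 0 ≤ y → y < x → h y ≤ g x := by
    intro x hx1
    have hx : 0 ≤ x := by linarith
    have hle : ∀ ε ∈ Ioi (0 : ℝ), h ((x + ε) / (1 + ε)) ≤ h x := fun ε hε => by
      have hε' : 0 < ε := hε
      refine hm (hu0 hx hε) hx (sub_nonpos.1 ?_)
      rw [hx' x ε hε]
      exact div_nonpos_of_nonpos_of_nonneg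
        (mul_nonpos_of_nonpos_of_nonneg (by linarith) hε'.le) (by linarith)
    have hmon : AntitoneOn (fun ε : ℝ => h ((x + ε) / (1 + ε))) (Ioi 0) := by
      intro ε hε δ hδ hεδ
      have hε' : 0 < ε := hε
      have hδ' : 0 < δ := hδ
      refine hm (hu0 hx hδ) (hu0 hx hε) (sub_nonpos.1 ?_)
      rw [hdiff x ε δ hε hδ]
      exact div_nonpos_of_nonpos_of_nonneg
        (mul_nonpos_of_nonpos_of_nonneg (by linarith) (by linarith)) (by positivity)
    have hL := hmon.tendsto_nhdsGT ⟨h x, by rintro _ ⟨ε, hε, rfl⟩; exact hle ε hε⟩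
    rw [hgL hx hL] at hL
    refine ⟨le_of_tendsto hL (eventually_nhdsWithin_of_forall hle), fun y hy0 hy => ?_⟩
    refine ge_of_tendsto hL ?_
    filter_upwards [(tendsto_shift_div x).eventually_const_lt hy, self_mem_nhdsWithin] with ε h2 h3
    exact hm hy0 (hu0 hx h3) h2.le
  have hgat : ∀ x, 0 < x → ContinuousAt g x := fun x hx => hg.continuousAt (Ici_mem_nhds hx)
  rcases lt_trichotomy x 1 with hx1 | rfl | hx1
  · refine le_antisymm (hlt x hx hx1).1 ?_
    rcases hx.eq_or_lt with rfl | hx0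
    -- At `0` there are no points on the left to compare with; right continuity of `h` replaces
    -- them.
    · refine ge_of_tendsto (hcont.tendsto.mono_left (nhdsWithin_mono _ Ioi_subset_Ici_self)) ?_
      filter_upwards [self_mem_nhdsWithin] with y hy using (hlt 0 le_rfl hx1).2 y hy
    · refine le_of_tendsto ((hgat x hx0).tendsto.mono_left (nhdsWithin_le_nhds (s := Iio x))) ?_
      filter_upwards [Ioo_mem_nhdsLT hx0] with z hz
      exact (hlt z hz.1.le (hz.2.trans hx1)).2 x hz.2
  · simp [h1]
  · refine le_antisymm ?_ (hgt x hx1).1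
    refine ge_of_tendsto ((hgat x (by linarith)).tendsto.mono_left
      (nhdsWithin_le_nhds (s := Ioi x))) ?_
    filter_upwards [self_mem_nhdsWithin] with z hz
    have hz' : x < z := hz
    exact (hgt z (hx1.trans hz')).2 x hx hz'

/-- Absolute monotonicity on the line in terms of iterated derivatives. -/
lemma absolutelyMonotoneOn_univ_iff {f : ℝ → ℝ} : AbsolutelyMonotoneOn f univ ↔
    ContDiff ℝ ∞ f ∧ ∀ (n : ℕ) (t : ℝ), 0 ≤ iteratedDeriv n f t := by
  rw [AbsolutelyMonotoneOn.iff_iteratedDerivWithin_nonneg uniqueDiffOn_univ, contDiffOn_univ]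
  simp [iteratedDerivWithin_univ]

/-- Each differentiation of `f (-t)` contributes a sign, which cancels the alternating factor. -/
lemma completelyMonotone_comp_neg_iff {f : ℝ → ℝ} : CompletelyMonotone (fun t => f (-t)) ↔
    ContDiff ℝ ∞ f ∧ ∀ (n : ℕ) (t : ℝ), 0 ≤ iteratedDeriv n f t := by
  have h1 : ∀ (n : ℕ) (t : ℝ),
      (-1 : ℝ) ^ n * iteratedDeriv n (fun t => f (-t)) t = iteratedDeriv n f (-t) := by
    intro n t
    rw [iteratedDeriv_comp_neg, smul_eq_mul, ← mul_assoc, ← mul_pow]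
    simp
  unfold CompletelyMonotone
  simp only [h1]
  constructor
  · rintro ⟨h2, h3⟩
    exact ⟨by simpa [Function.comp_def] using h2.comp contDiff_neg,
      fun n t => by simpa using h3 n (-t)⟩
  · rintro ⟨h2, h3⟩
    exact ⟨h2.comp contDiff_neg, fun n t => h3 n (-t)⟩

end Scalars

/-! ### The equivalences and the criterion for geodesic means. -/

theorem theorem3p9 (h : ℝ → ℝ) (hnonneg : ∀ x : ℝ, 0 ≤ x → 0 ≤ h x)
    (hmono : OperatorMonotone h) (hcont : ContinuousWithinAt h (Ici 0) 0) :
    List.TFAE [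
      (∃ ν : Measure unitInterval, IsFiniteMeasure ν ∧
        ∀ x : ℝ, 0 ≤ x → h x = ∫ l : unitInterval, x ^ (l : ℝ) ∂ν),
      AbsolutelyMonotoneOn (fun t : ℝ => h (Real.exp t)) univ,
      (ContDiff ℝ ∞ (fun t : ℝ => h (Real.exp t)) ∧
        ∀ (n : ℕ) (t : ℝ), 0 ≤ iteratedDeriv n (fun s : ℝ => h (Real.exp s)) t),
      CompletelyMonotone (fun t : ℝ => h (Real.exp (-t)))] ∧
    (h 1 = 1 →
      (IsGeodesicMean h ↔ AbsolutelyMonotoneOn (fun t : ℝ => h (Real.exp t)) univ)) := by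
  have h23 := absolutelyMonotoneOn_univ_iff (f := fun t : ℝ => h (Real.exp t))
  have h43 := completelyMonotone_comp_neg_iff (f := fun t : ℝ => h (Real.exp t))
  have h13 : (∃ ν : Measure unitInterval, IsFiniteMeasure ν ∧
      ∀ x : ℝ, 0 ≤ x → h x = ∫ l : unitInterval, x ^ (l : ℝ) ∂ν) ↔
      (ContDiff ℝ ∞ (fun t : ℝ => h (Real.exp t)) ∧
        ∀ (n : ℕ) (t : ℝ), 0 ≤ iteratedDeriv n (fun s : ℝ => h (Real.exp s)) t) := by
    constructor
    · rintro ⟨ν, hν, hr⟩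
      have h1 : (fun t : ℝ => h (Real.exp t)) =
          ProbabilityTheory.mgf (fun l : unitInterval => (l : ℝ)) ν :=
        funext fun t => by rw [hr _ (Real.exp_pos t).le, integral_exp_rpow]
      rw [h1]
      exact ⟨contDiff_mgf_unitInterval, iteratedDeriv_mgf_unitInterval_nonneg⟩
    · rintro ⟨hf, hn⟩
      obtain ⟨ν, hν, hr⟩ := exists_measure_of_iteratedDeriv_nonneg hf hn fun t ht => by
        simpa using hmono.le_mul hnonneg (Real.one_le_exp ht)
      have hpos : ∀ x : ℝ, 0 < x → h x = ∫ l : unitInterval, x ^ (l : ℝ) ∂ν := by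
        intro x hx
        have h1 := hr (Real.log x)
        simp only [Real.exp_log hx] at h1
        rw [h1]
        exact integral_congr_ae (Eventually.of_forall fun l => (Real.rpow_def_of_pos hx _).symm)
      refine ⟨ν, hν, fun x hx => ?_⟩
      rcases hx.eq_or_lt with rfl | hx
      -- The value at `0` follows by right continuity of both sides; an atom of `ν` at `0` is
      -- counted through `0^0 = 1`.
      · refine tendsto_nhds_unique
          (hcont.tendsto.mono_left (nhdsWithin_mono _ Ioi_subset_Ici_self))
          (((continuousOn_integral_rpow (ν := ν) 0 (mem_Ici.2 le_rfl)).tendsto.mono_left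
            (nhdsWithin_mono _ Ioi_subset_Ici_self)).congr' ?_)
        filter_upwards [self_mem_nhdsWithin] with y hy using (hpos y hy).symm
      · exact hpos x hx
  refine ⟨?_, fun h1 => ?_⟩
  · tfae_have 1 ↔ 3 := h13
    tfae_have 2 ↔ 3 := h23
    tfae_have 4 ↔ 3 := h43
    tfae_finish
  · rw [h23, ← h13]
    constructor
    · rintro ⟨ν, hν, hr⟩
      refine ⟨ν, inferInstance, fun x hx => ?_⟩
      refine eq_integral_rpow_of_operatorMean hmono.monotoneOn hcont h1 (fun y hy => ?_) hx
      exact (hr 1 _ _ (posSemidef_diagonal_ofReal fun _ => zero_le_one)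
        (posSemidef_diagonal_ofReal fun _ => hy) 0 0).2
    · rintro ⟨ν, hν, hr⟩
      refine ⟨ν, ⟨?_⟩, fun n A B hA hB i j => operatorMean_apply_eq_integral hA hB hr i j⟩
      -- At `x = 1` every power is `1`, so `h 1 = 1` says that `ν` has total mass `1`.
      have h2 := hr 1 zero_le_one
      simp only [h1, Real.one_rpow, integral_const, smul_eq_mul, mul_one] at h2
      have h3 := measureReal_def ν univ ▸ h2.symm
      rwa [ENNReal.toReal_eq_one_iff] at h3
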